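/- Let $\mathcal H$ be a real linear space with a non-degenerate symplectic (i.e. alternating bilinear) form $\sigma$, and let $\mathrm{CCR}(\mathcal H)$ be its Weyl algebra: the C*-algebra generated by unitaries $W(f)$, $f\in\mathcal H$, with $W(f)W(g)=e^{\mathrm i\sigma(f,g)}W(f+g)$. Let $n\ge 1$ be an integer. On $\mathcal H_n=\mathcal H\oplus\dots\oplus\mathcal H$ ($n$ summands) put $\sigma_n(f,g)=\sum_i\sigma(f_i,g_i)$, and identify $\mathrm{CCR}(\mathcal H_n)$ with $\mathrm{CCR}(\mathcal H)\otimes\dots\otimes\mathrm{CCR}(\mathcal H)$ through $W(f_1\oplus\dots\oplus f_n)=W(f_1)\otimes\dots\otimes W(f_n)$. A coarse-graining is a unital 2-positive linear map between C*-algebras. A coarse-graining $\tau:\mathcal N\to\mathcal M$ is sufficient for a family $(\varphi_\theta)$ of states of $\mathcal M$ if there is a coarse-graining $\beta:\mathcal M\to\mathcal N$ with $\varphi_\theta\circ\tau\circ\beta=\varphi_\theta$ for every $\theta$. Fix a bilinear form $\alpha:\mathcal H\times\mathcal H\to\mathbb R$ with $\alpha(f,f)\ge 0$ and $\sigma(f,g)^2\le\alpha(f,f)\,\alpha(g,g)$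 for all $f,g\in\mathcal H$. Then: 1. For every linear functional $m:\mathcal H\to\mathbb R$ there is a unique state $\varphi_{m,\alpha}$ of $\mathrm{CCR}(\mathcal H)$ with $\varphi_{m,\alpha}(W(f))=\exp\left(\mathrm i\,m(f)-\tfrac12\alpha(f,f)\right)$ for all $f\in\mathcal H$, and a unique state $\psi_{m,\alpha}=\varphi_{m,\alpha}\otimes\dots\otimes\varphi_{m,\alpha}$ of $\mathrm{CCR}(\mathcal H_n)$ with $\psi_{m,\alpha}(W(f_1\oplus\dots\oplus f_n))=\prod_i\varphi_{m,\alpha}(W(f_i))$. 2. There is a unique completely positive map $T:\mathrm{CCR}(\mathcal H)\to\mathrm{CCR}(\mathcal H_n)$ with $T(W(f))=W\left(n^{-1/2}(f\oplus\dots\oplus f)\right)$ for all $f\in\mathcal H$. 3. $T$ is a coarse-graining and is sufficient for the family $\{\psi_{m,\alpha}: m \text{ a linear functional on } \mathcal H\}$. Moreover, there is a completely positive unital map $S_\alpha:\mathrm{CCR}(\mathcal H_n)\to\mathrm{CCR}(\mathcal H)$ with $$S_\alpha(W(f_1\oplus\dots\oplus f_n))=\exp\left(\tfrac1{2n}\,\alpha\left({\textstyle\sum_i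 f_i,\sum_i f_i}\right)-\tfrac12{\textstyle\sum_i}\alpha(f_i,f_i)\right)W\left(\tfrac1{\sqrt n}{\textstyle\sum_i f_i}\right)$$ and $\psi_{m,\alpha}\circ T\circ S_\alpha=\psi_{m,\alpha}$ for every $m$. -/

import Mathlib

open scoped CStarAlgebra InnerProductSpace

noncomputable section

namespace Weyl

/-! ### The Weyl algebra of a symplectic space -/

section Algebra

variable {H : Type*} [AddCommGroup H] [Module ℝ H]

/-- The Hilbert space `ℓ²(H)` over the discrete set `H`. -/
abbrev L2 (H : Type*) : Type _ := lp (fun _ : H => ℂ) 2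

/-- The phase `e^{i t}`. -/
def phase (t : ℝ) : ℂ := Complex.exp (t * Complex.I)

theorem norm_phase (t : ℝ) : ‖phase t‖ = 1 := Complex.norm_exp_ofReal_mul_I t

theorem phase_add (s t : ℝ) : phase (s + t) = phase s * phase t := by
  simp [phase, add_mul, Complex.exp_add]

theorem phase_zero : phase 0 = 1 := by simp [phase]

/-- The Weyl operator as an isometry of `ℓ²(H)`. On the canonical basis it acts as
`W(f) δ_h = e^{i σ(f,h)} δ_{f+h}`, that is `(W(f) x)(g) = e^{i σ(f, g - f)} x(g - f)`. -/
def weylIsometry (σ : LinearMap.BilinForm ℝ H) (f : H) : L2 H →ₗᵢ[ℂ] L2 H where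
  toFun x := ⟨fun g => phase (σ f (g - f)) * x (g - f), by
    apply memℓp_gen
    have h := (memℓp_gen_iff (p := 2) (by simp)).1 x.2
    simpa [norm_phase, Function.comp_def] using h.comp_injective (sub_left_injective (b := f))⟩
  map_add' x y := by
    ext g
    simp only [lp.coeFn_add, Pi.add_apply]
    ring
  map_smul' c x := by
    ext g
    simp only [lp.coeFn_smul, Pi.smul_apply, smul_eq_mul, RingHom.id_apply]
    ring
  norm_map' x := by
    rw [lp.norm_eq_tsum_rpow (by simp), lp.norm_eq_tsum_rpow (by simp)]
    congr 1
    simpa [norm_phase] using (Equiv.subRight f).tsum_eq fun g => ‖x g‖ ^ (2 : ℝ)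

theorem weylIsometry_apply (σ : LinearMap.BilinForm ℝ H) (f : H) (x : L2 H) (g : H) :
    weylIsometry σ f x g = phase (σ f (g - f)) * x (g - f) := rfl

/-- The Weyl operators satisfy `W(f) W(g) = e^{i σ(f,g)} W(f+g)`. -/
theorem weylIsometry_mul (σ : LinearMap.BilinForm ℝ H) (f g : H) (x : L2 H) :
    weylIsometry σ f (weylIsometry σ g x) = phase (σ f g) • weylIsometry σ (f + g) x := by
  ext h
  simp only [weylIsometry_apply, lp.coeFn_smul, Pi.smul_apply, smul_eq_mul]
  rw [← sub_sub, ← mul_assoc, ← mul_assoc, ← phase_add, ← phase_add]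
  congr 2
  simp only [map_sub, map_add, LinearMap.add_apply]
  ring

theorem weylIsometry_zero (σ : LinearMap.BilinForm ℝ H) (x : L2 H) :
    weylIsometry σ 0 x = x := by
  ext h
  simp [weylIsometry_apply, phase_zero]

theorem weylIsometry_surjective (σ : LinearMap.BilinForm ℝ H) (f : H) :
    Function.Surjective (weylIsometry σ f) := fun x =>
  ⟨phase (-σ f (-f)) • weylIsometry σ (-f) x, by
    rw [map_smul, weylIsometry_mul, smul_smul, ← phase_add]
    simp [phase_zero, weylIsometry_zero]⟩

/-- The Weyl operator `W(f)` as a bounded operator on `ℓ²(H)`. -/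
def weylOp (σ : LinearMap.BilinForm ℝ H) (f : H) : L2 H →L[ℂ] L2 H :=
  (weylIsometry σ f).toContinuousLinearMap

/-- The Weyl algebra as a C⋆-subalgebra of `B(ℓ²(H))`: the norm closure of the ⋆-algebra generated
by the Weyl operators `W(f)`, `f ∈ H`. -/
def ccrSubalgebra (σ : LinearMap.BilinForm ℝ H) : StarSubalgebra ℂ (L2 H →L[ℂ] L2 H) :=
  (StarAlgebra.adjoin ℂ (Set.range (weylOp σ))).topologicalClosure

/-- The Weyl algebra `CCR(H, σ)`: the C⋆-algebra generated by unitaries `W(f)`, `f ∈ H`, with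
`W(f) W(g) = e^{i σ(f,g)} W(f+g)`. For a non-degenerate symplectic form `σ` such a C⋆-algebra is
unique up to a ⋆-isomorphism that respects the unitaries `W(f)`; it is realized here on `ℓ²(H)`. -/
def CCR (σ : LinearMap.BilinForm ℝ H) : Type _ := ccrSubalgebra σ

/-- The C⋆-algebra structure of `CCR(H, σ)`, inherited from `B(ℓ²(H))`. (It is semireducible on
purpose: instance search then treats `CCR(H, σ)` as a type of its own.) -/
def cstarAlgebraCCR (σ : LinearMap.BilinForm ℝ H) : CStarAlgebra (ccrSubalgebra σ) :=
  StarSubalgebra.cstarAlgebra (ccrSubalgebra σ)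
    (h_closed := StarSubalgebra.isClosed_topologicalClosure _)

instance (σ : LinearMap.BilinForm ℝ H) : CStarAlgebra (CCR σ) := cstarAlgebraCCR σ

/-- The usual order of a C⋆-algebra: `a ≤ b` iff `b - a` is a positive element. -/
instance (σ : LinearMap.BilinForm ℝ H) : PartialOrder (CCR σ) := CStarAlgebra.spectralOrder _

instance (σ : LinearMap.BilinForm ℝ H) : StarOrderedRing (CCR σ) :=
  CStarAlgebra.spectralOrderedRing _

/-- The Weyl unitary `W(f)` as an element of `CCR(H, σ)`. -/
def W (σ : LinearMap.BilinForm ℝ H) (f : H) : CCR σ :=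
  ⟨weylOp σ f, StarSubalgebra.le_topologicalClosure _
    (StarAlgebra.subset_adjoin ℂ _ (Set.mem_range_self f))⟩

/-- The canonical commutation relation in Weyl form. -/
theorem W_mul_W (σ : LinearMap.BilinForm ℝ H) (f g : H) :
    W σ f * W σ g = phase (σ f g) • W σ (f + g) :=
  Subtype.ext (ContinuousLinearMap.ext fun x => weylIsometry_mul σ f g x)

theorem W_zero (σ : LinearMap.BilinForm ℝ H) : W σ 0 = 1 :=
  Subtype.ext (ContinuousLinearMap.ext fun x => weylIsometry_zero σ x)

theorem W_mem_unitary (σ : LinearMap.BilinForm ℝ H) (f : H) :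
    W σ f ∈ unitary (CCR σ) := by
  have h := (Unitary.linearIsometryEquiv (𝕜 := ℂ) (H := L2 H)|>.symm
    (LinearIsometryEquiv.ofSurjective (weylIsometry σ f) (weylIsometry_surjective σ f))).2
  have e : ((Unitary.linearIsometryEquiv (𝕜 := ℂ) (H := L2 H)|>.symm
    (LinearIsometryEquiv.ofSurjective (weylIsometry σ f) (weylIsometry_surjective σ f))) :
      L2 H →L[ℂ] L2 H) = weylOp σ f := rfl
  rw [e] at h
  exact ⟨Subtype.ext h.1, Subtype.ext h.2⟩

/-- The form induced on the direct sum `H ⊕ ⋯ ⊕ H` of `n` copies of `H`, the elements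
`f = f₁ ⊕ ⋯ ⊕ fₙ` of which are the functions `Fin n → H`: the form
`(f, g) ↦ ∑ i, σ (f i) (g i)`. -/
def directSumForm (σ : LinearMap.BilinForm ℝ H) (n : ℕ) : LinearMap.BilinForm ℝ (Fin n → H) :=
  ∑ i : Fin n, σ.compl₁₂ (LinearMap.proj i) (LinearMap.proj i)

theorem directSumForm_apply (σ : LinearMap.BilinForm ℝ H) (n : ℕ) (f g : Fin n → H) :
    directSumForm σ n f g = ∑ i, σ (f i) (g i) := by
  simp [directSumForm, LinearMap.sum_apply]

end Algebra

/-! ### States, coarse-grainings and sufficiency -/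

section Statistics

/-- A state of a unital C⋆-algebra: a linear functional `φ` with `φ(1) = 1 = ‖φ‖`. -/
def IsState {A : Type*} [CStarAlgebra A] (φ : A →L[ℂ] ℂ) : Prop :=
  φ 1 = 1 ∧ ‖φ‖ = 1

/-- A coarse-graining: a unital 2-positive linear map between C⋆-algebras. -/
structure IsCoarseGraining {A B : Type*} [CStarAlgebra A] [PartialOrder A] [StarOrderedRing A]
    [CStarAlgebra B] [PartialOrder B] [StarOrderedRing B]
    (τ : A →ₗ[ℂ] B) : Prop where
  map_one : τ 1 = 1
  two_positive : ∀ M : CStarMatrix (Fin 2) (Fin 2) A, 0 ≤ M → 0 ≤ M.map τ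

/-- The coarse-graining `τ : N → M` is sufficient for the family `φ θ` of states of `M`: there is
a coarse-graining `β : M → N` with `φ θ ∘ τ ∘ β = φ θ` for every `θ`. -/
structure IsSufficient {N M Θ : Type*} [CStarAlgebra N] [PartialOrder N] [StarOrderedRing N]
    [CStarAlgebra M] [PartialOrder M] [StarOrderedRing M]
    (τ : N →ₗ[ℂ] M) (φ : Θ → M →L[ℂ] ℂ) : Prop where
  isCoarseGraining : IsCoarseGraining τ
  exists_recovery : ∃ β : M →ₗ[ℂ] N, IsCoarseGraining β ∧ ∀ θ a, φ θ (τ (β a)) = φ θ a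

variable {H : Type*} [AddCommGroup H] [Module ℝ H]

/-- `φ` is the Gaussian (quasifree) state with mean `m` and variance form `α`:
a state with `φ(W(f)) = exp(i m(f) - α(f,f)/2)`. -/
def IsGaussianState (σ α : LinearMap.BilinForm ℝ H) (m : H →ₗ[ℝ] ℝ) (φ : CCR σ →L[ℂ] ℂ) : Prop :=
  IsState φ ∧ ∀ f, φ (W σ f) = Complex.exp (m f * Complex.I - (1 / 2 : ℂ) * α f f)

/-- `ψ` is the product state `φ₁ ⊗ ⋯ ⊗ φₙ` on `CCR(H ⊕ ⋯ ⊕ H)`, which is identified with the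
tensor product `CCR(H) ⊗ ⋯ ⊗ CCR(H)` through `W(f₁ ⊕ ⋯ ⊕ fₙ) = W(f₁) ⊗ ⋯ ⊗ W(fₙ)`. (The linear
span of the Weyl unitaries is dense, so that the values on them determine the state.) -/
def IsProductState (σ : LinearMap.BilinForm ℝ H) {n : ℕ} (φ : Fin n → CCR σ →L[ℂ] ℂ)
    (ψ : CCR (directSumForm σ n) →L[ℂ] ℂ) : Prop :=
  IsState ψ ∧ ∀ f : Fin n → H, ψ (W (directSumForm σ n) f) = ∏ i, φ i (W σ (f i))

end Statistics

end Weyl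

end

open scoped CStarAlgebra InnerProductSpace

noncomputable section

namespace Weyl

/-! ### The dense ⋆-algebra spanned by the Weyl unitaries -/

section WeylSpan

variable {H : Type*} [AddCommGroup H] [Module ℝ H]

/-! All the maps here are quasifree, `W(f) ↦ b(f) W(B f)` with `b` Gaussian, and one construction,
`exists_quasifree`, produces them. On the span of the Weyl unitaries such a map is defined freely,
since these are linearly independent (`linearIndependent_W`). It is completely positive there
because the kernel `e^{i(σ₂(Bf,Bg) - σ₁(f,g))} b(g - f)` is positive semidefinite: up to a rank-one
factor it is the entrywise exponential of `β - i(σ₁ - σ₂ ∘ B)`, with `β` symmetrised, which is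
positive when `β` dominates `σ₁ - σ₂ ∘ B` (`posSemidef_gaussian`).

Continuity in the operator norm of `ℓ²(H)` is the analytic point. Powers of a finite combination of
Weyl unitaries involve only polynomially many unitaries, and the `ℓ²` norm of the coefficients is at
most the operator norm. Iterated Cauchy–Schwarz then makes a positive functional bounded by `1` on
the unitaries contractive (`re_star_mul_self_le`). With a Schwarz inequality this bounds the map
itself, which therefore extends to the closure; complete positivity survives the limit.

The states come from `B = 0`, `T` from the symplectic diagonal embedding with `β = 0`, and `S` from
the normalised sum. For `S`, both `σ` and `α` split along the diagonal and its complement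
(`directSumForm_center`), so the domination needed is that of `σ` by `α` on the centred vectors. The
factor in `S` restores exactly the variance lost by projecting to the diagonal, and the projection
does not change the mean; hence `ψ ∘ T ∘ S = ψ` for all `m` with a single `S`. Uniqueness is density
of the Weyl span. -/

/-- The inclusion of `CCR(H, σ)` into `B(ℓ²(H))`. -/
def toOp (σ : LinearMap.BilinForm ℝ H) : CCR σ →⋆ₐ[ℂ] (L2 H →L[ℂ] L2 H) where
  toFun a := a.1
  map_one' := rfl
  map_mul' _ _ := rfl
  map_zero' := rfl
  map_add' _ _ := rfl
  commutes' _ := rfl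
  map_star' _ := rfl

theorem isometry_toOp (σ : LinearMap.BilinForm ℝ H) : Isometry (toOp σ) :=
  AddMonoidHomClass.isometry_of_norm _ fun _ => rfl

theorem toOp_W (σ : LinearMap.BilinForm ℝ H) (f : H) (x : L2 H) :
    toOp σ (W σ f) x = weylIsometry σ f x := rfl

theorem star_W (σ : LinearMap.BilinForm ℝ H) (f : H) :
    star (W σ f) = phase (σ f f) • W σ (-f) := by
  have h : W σ f * (phase (σ f f) • W σ (-f)) = 1 := by
    rw [mul_smul_comm, W_mul_W, smul_smul, ← phase_add]
    simp [phase_zero, W_zero]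
  calc star (W σ f) = star (W σ f) * (W σ f * (phase (σ f f) • W σ (-f))) := by rw [h, mul_one]
    _ = _ := by rw [← mul_assoc, (W_mem_unitary σ f).1, one_mul]

theorem star_W_mul_W {σ : LinearMap.BilinForm ℝ H} (hσ : σ.IsAlt) (f g : H) :
    star (W σ f) * W σ g = phase (-σ f g) • W σ (g - f) := by
  rw [star_W, hσ f, phase_zero, one_smul, W_mul_W, map_neg, LinearMap.neg_apply,
    neg_add_eq_sub]

/-- The linear span of the Weyl unitaries, a ⋆-subalgebra of `CCR(H, σ)`. -/
def weylSpan (σ : LinearMap.BilinForm ℝ H) : StarSubalgebra ℂ (CCR σ) where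
  __ := (Submodule.span ℂ (Set.range (W σ))).toSubalgebra
    (Submodule.subset_span ⟨0, W_zero σ⟩) (fun a b ha hb => by
      have h := Submodule.mul_mem_mul ha hb
      rw [Submodule.span_mul_span] at h
      refine Submodule.span_le.2 ?_ h
      rintro _ ⟨_, ⟨f, rfl⟩, _, ⟨g, rfl⟩, rfl⟩
      simp only [W_mul_W]
      exact Submodule.smul_mem _ _ (Submodule.subset_span ⟨_, rfl⟩))
  star_mem' := fun {a} ha => by
    change a ∈ Submodule.span ℂ (Set.range (W σ)) at ha
    change star a ∈ Submodule.span ℂ (Set.range (W σ))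
    induction ha using Submodule.span_induction with
    | mem x hx =>
      obtain ⟨f, rfl⟩ := hx
      rw [star_W]
      exact Submodule.smul_mem _ _ (Submodule.subset_span ⟨_, rfl⟩)
    | zero => simp
    | add x y _ _ hx hy => rw [star_add]; exact add_mem hx hy
    | smul c x _ hx => rw [star_smul]; exact Submodule.smul_mem _ _ hx

/-- The vector `δ₀` of the canonical basis of `ℓ²(H)`. -/
def vac (H : Type*) [AddCommGroup H] : L2 H := by
  classical exact lp.single 2 (0 : H) (1 : ℂ)

omit [Module ℝ H] in
theorem norm_vac : ‖vac H‖ = 1 := by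
  classical simp [vac, lp.norm_single]

theorem weylIsometry_vac [DecidableEq H] (σ : LinearMap.BilinForm ℝ H) (f g : H) :
    weylIsometry σ f (vac H) g = if g = f then 1 else 0 := by
  rw [weylIsometry_apply]
  by_cases h : g = f
  · subst h
    simp [vac, phase_zero, lp.single_apply]
  · simp [vac, h, lp.single_apply, sub_eq_zero]

theorem toOp_sum_vac (σ : LinearMap.BilinForm ℝ H) (F : Finset H) (c : H → ℂ) {g : H}
    (hg : g ∈ F) : toOp σ (∑ f ∈ F, c f • W σ f) (vac H) g = c g := by
  classical
  simp only [map_sum, map_smul, sum_apply, smul_apply, toOp_W, lp.coeFn_sum, Finset.sum_apply, lp.coeFn_smul, Pi.smul_apply, weylIsometry_vac]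
  simp [hg]

/-- Since `W(f) δ₀ = δ_f`, applying the operator to the unit vector `δ₀` displays its coefficients.
-/
theorem sum_norm_sq_le (σ : LinearMap.BilinForm ℝ H) (F : Finset H) (c : H → ℂ) :
    ∑ f ∈ F, ‖c f‖ ^ 2 ≤ ‖∑ f ∈ F, c f • W σ f‖ ^ 2 := by
  set a := ∑ f ∈ F, c f • W σ f with ha
  have h1 : ∑ f ∈ F, ‖toOp σ a (vac H) f‖ ^ 2 ≤ ‖toOp σ a (vac H)‖ ^ 2 := by
    have := lp.sum_rpow_le_norm_rpow (p := 2) (by simp) (toOp σ a (vac H)) F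
    simpa using this
  have h2 : ‖toOp σ a (vac H)‖ ≤ ‖a‖ := by
    have := (toOp σ a).le_opNorm (vac H)
    rwa [norm_vac, mul_one] at this
  calc ∑ f ∈ F, ‖c f‖ ^ 2 = ∑ f ∈ F, ‖toOp σ a (vac H) f‖ ^ 2 :=
        Finset.sum_congr rfl fun f hf => by rw [ha, toOp_sum_vac σ F c hf]
    _ ≤ ‖toOp σ a (vac H)‖ ^ 2 := h1
    _ ≤ ‖a‖ ^ 2 := by gcongr

theorem linearIndependent_W (σ : LinearMap.BilinForm ℝ H) : LinearIndependent ℂ (W σ) := by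
  rw [linearIndependent_iff']
  intro F c h g hg
  rw [← toOp_sum_vac σ F c hg, h]
  simp

/-- The Weyl unitaries as a basis of their linear span. -/
def weylBasis (σ : LinearMap.BilinForm ℝ H) : Module.Basis H ℂ (weylSpan σ) :=
  Module.Basis.span (linearIndependent_W σ)

theorem coe_weylBasis (σ : LinearMap.BilinForm ℝ H) (f : H) : (weylBasis σ f : CCR σ) = W σ f :=
  congrArg Subtype.val (Module.Basis.span_apply (linearIndependent_W σ) f)

theorem weylBasis_mul (σ : LinearMap.BilinForm ℝ H) (f g : H) :
    weylBasis σ f * weylBasis σ g = phase (σ f g) • weylBasis σ (f + g) :=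
  Subtype.ext (by simpa [coe_weylBasis] using W_mul_W σ f g)

theorem weylBasis_zero (σ : LinearMap.BilinForm ℝ H) : weylBasis σ 0 = 1 :=
  Subtype.ext (by simpa [coe_weylBasis] using W_zero σ)

theorem star_weylBasis_mul {σ : LinearMap.BilinForm ℝ H} (hσ : σ.IsAlt) (f g : H) :
    star (weylBasis σ f) * weylBasis σ g = phase (-σ f g) • weylBasis σ (g - f) :=
  Subtype.ext (by simpa [coe_weylBasis] using star_W_mul_W hσ f g)

theorem star_weylBasis {σ : LinearMap.BilinForm ℝ H} (hσ : σ.IsAlt) (f : H) :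
    star (weylBasis σ f) = weylBasis σ (-f) :=
  Subtype.ext (by simp [coe_weylBasis, star_W, hσ f, phase_zero])

/-- The inclusion of the span of the Weyl unitaries into `CCR(H, σ)`. -/
def weylIncl (σ : LinearMap.BilinForm ℝ H) : weylSpan σ →ₗ[ℂ] CCR σ :=
  (weylSpan σ).subtype.toAlgHom.toLinearMap

theorem weylIncl_apply (σ : LinearMap.BilinForm ℝ H) (a : weylSpan σ) : weylIncl σ a = a := rfl

/-- The span is already a ⋆-algebra, so it contains the ⋆-algebra whose closure defines `CCR σ`;
density is pulled back along the isometry `toOp`. -/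
theorem denseRange_weylIncl (σ : LinearMap.BilinForm ℝ H) : DenseRange (weylIncl σ) := by
  intro x
  rw [(Isometry.isEmbedding (isometry_toOp σ)).isInducing.closure_eq_preimage_closure_image]
  have hx : toOp σ x ∈ closure ((StarAlgebra.adjoin ℂ (Set.range (weylOp σ)) :
    StarSubalgebra ℂ (L2 H →L[ℂ] L2 H)) : Set (L2 H →L[ℂ] L2 H)) := x.2
  refine closure_mono ?_ hx
  have h : StarAlgebra.adjoin ℂ (Set.range (weylOp σ)) ≤ (weylSpan σ).map (toOp σ) := by
    refine StarAlgebra.adjoin_le ?_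
    rintro _ ⟨f, rfl⟩
    exact ⟨W σ f, Submodule.subset_span ⟨f, rfl⟩, rfl⟩
  intro y hy
  obtain ⟨a, ha, rfl⟩ := h hy
  exact ⟨a, ⟨⟨a, ha⟩, rfl⟩, rfl⟩

/-- Continuous linear maps on `CCR(H, σ)` are determined by their values on the Weyl unitaries. -/
theorem ext_W {σ : LinearMap.BilinForm ℝ H} {E : Type*} [AddCommGroup E] [Module ℂ E]
    [TopologicalSpace E] [T2Space E] {S T : CCR σ →ₗ[ℂ] E} (hS : Continuous S)
    (hT : Continuous T) (h : ∀ f, S (W σ f) = T (W σ f)) : S = T := by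
  have h' : S ∘ₗ weylIncl σ = T ∘ₗ weylIncl σ :=
    (weylBasis σ).ext fun f => by simpa [weylIncl_apply, coe_weylBasis] using h f
  exact DFunLike.coe_injective
    ((denseRange_weylIncl σ).equalizer hS hT (funext fun a => LinearMap.congr_fun h' a))

end WeylSpan

end Weyl

/-! ### Positive semidefinite kernels -/

namespace Matrix

open scoped ComplexOrder

variable {n : Type*} [Finite n]

theorem PosSemidef.hadamard_pow {M : Matrix n n ℂ} (hM : M.PosSemidef) (k : ℕ) :
    (Matrix.of fun i j => M i j ^ k).PosSemidef := by
  induction k with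
  | zero =>
    have h := posSemidef_vecMulVec_self_star (fun _ : n => (1 : ℂ))
    have e : (of fun i j => M i j ^ 0) = vecMulVec (fun _ : n => (1 : ℂ)) (star fun _ => 1) := by
      ext i j
      simp [vecMulVec_apply]
    exact e ▸ h
  | succ k ih =>
    have e : (of fun i j => M i j ^ (k + 1)) = (of fun i j => M i j ^ k) ⊙ M := by
      ext i j
      simp [pow_succ]
    exact e ▸ ih.hadamard hM

theorem PosSemidef.of_tendsto {ι : Type*} {l : Filter ι} [l.NeBot] {M : ι → Matrix n n ℂ}
    {N : Matrix n n ℂ} (hM : ∀ k, (M k).PosSemidef)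
    (h : ∀ i j, Filter.Tendsto (fun k => M k i j) l (nhds (N i j))) : N.PosSemidef := by
  have := Fintype.ofFinite n
  refine .of_dotProduct_mulVec_nonneg ?_ fun x => ?_
  · ext i j
    refine tendsto_nhds_unique ((h j i).star) ?_
    simpa [← (hM _).isHermitian.apply i j] using h i j
  · refine ge_of_tendsto (x := l) (f := fun k => star x ⬝ᵥ (M k *ᵥ x)) ?_
      (.of_forall fun k => (hM k).dotProduct_mulVec_nonneg x)
    exact tendsto_finsetSum _ fun i _ => (tendsto_finsetSum _ fun j _ =>
      (h i j).mul_const _).const_mul _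

theorem PosSemidef.hadamard_exp {M : Matrix n n ℂ} (hM : M.PosSemidef) :
    (Matrix.of fun i j => Complex.exp (M i j)).PosSemidef := by
  refine .of_tendsto (l := Filter.atTop)
    (M := fun N => ∑ k ∈ Finset.range N, ((k.factorial : ℝ)⁻¹ : ℂ) • Matrix.of fun i j => M i j ^ k)
    (fun N => posSemidef_sum _ fun k _ => (hM.hadamard_pow k).smul ?_) fun i j => ?_
  · rw [← Complex.ofReal_inv, Complex.zero_le_real]
    positivity
  · have := (NormedSpace.exp_series_hasSum_exp' (𝕂 := ℂ) (M i j)).tendsto_sum_nat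
    rw [← Complex.exp_eq_exp_ℂ] at this
    simpa [Matrix.sum_apply] using this

/-- Writing `K = Lᴴ L` turns the double sum into a sum of squared norms. -/
theorem PosSemidef.re_sum_inner_nonneg {n : Type*} [Fintype n] {K : Matrix n n ℂ}
    (hK : K.PosSemidef) {E : Type*}
    [NormedAddCommGroup E] [InnerProductSpace ℂ E] (u : n → E) :
    0 ≤ (∑ i, ∑ j, K i j * ⟪u i, u j⟫_ℂ).re := by
  classical
  obtain ⟨L, rfl⟩ : ∃ L : Matrix n n ℂ, K = Lᴴ * L := by
    open scoped MatrixOrder in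
    exact CStarAlgebra.nonneg_iff_eq_star_mul_self.1 (nonneg_iff_posSemidef.2 hK)
  have h : ∑ i, ∑ j, (Lᴴ * L) i j * ⟪u i, u j⟫_ℂ
      = ∑ k, ⟪∑ i, L k i • u i, ∑ j, L k j • u j⟫_ℂ := by
    simp only [sum_inner, inner_sum, inner_smul_left, inner_smul_right, Matrix.mul_apply,
      Finset.sum_mul, conjTranspose_apply]
    rw [Finset.sum_comm]
    conv_rhs => rw [Finset.sum_comm]
    refine Finset.sum_congr rfl fun j _ => ?_
    rw [Finset.sum_comm]
    refine Finset.sum_congr rfl fun k _ => ?_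
    rw [Finset.mul_sum]
    refine Finset.sum_congr rfl fun i _ => ?_
    rw [starRingEnd_apply]
    ring
  rw [h, Complex.re_sum]
  exact Finset.sum_nonneg fun k _ => inner_self_nonneg (𝕜 := ℂ)

end Matrix

namespace Weyl

open scoped ComplexOrder

variable {H : Type*} [AddCommGroup H] [Module ℝ H]

/-- With `p`, `q` the combinations of the `v i` by the real and imaginary parts of `x`, the
quadratic form is `β(p,p) + β(q,q) + 2σ(p,q)`, nonnegative by domination and the inequality of
means. Symmetrising is needed because `β` need not be symmetric. -/
theorem posSemidef_form {σ β : LinearMap.BilinForm ℝ H} (hσ : σ.IsAlt)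
    (hβ : ∀ f, 0 ≤ β f f) (h : ∀ f g, σ f g ^ 2 ≤ β f f * β g g) {n : Type*} [Finite n]
    (v : n → H) :
    (Matrix.of fun i j => (((β (v i) (v j) + β (v j) (v i)) / 2 : ℝ) : ℂ)
      - (σ (v i) (v j) : ℝ) * Complex.I).PosSemidef := by
  have := Fintype.ofFinite n
  refine .of_dotProduct_mulVec_nonneg ?_ fun x => ?_
  · ext i j
    simp only [Matrix.conjTranspose_apply, Matrix.of_apply, star_sub, star_mul']
    have h' : σ (v j) (v i) = -σ (v i) (v j) := by rw [← LinearMap.IsAlt.neg hσ]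
    simp [h', add_comm, sub_eq_add_neg]
  · set p : H := ∑ i, (x i).re • v i with hp
    set q : H := ∑ i, (x i).im • v i with hq
    have key : star x ⬝ᵥ ((Matrix.of fun i j => (((β (v i) (v j) + β (v j) (v i)) / 2 : ℝ) : ℂ)
      - (σ (v i) (v j) : ℝ) * Complex.I).mulVec x)
        = ((β p p + β q q + 2 * σ p q : ℝ) : ℂ) := by
      have e (B : LinearMap.BilinForm ℝ H) (a b : n → ℝ) :
          B (∑ i, a i • v i) (∑ i, b i • v i) = ∑ i, ∑ j, a i * b j * B (v i) (v j) := by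
        simp only [map_sum, map_smul, LinearMap.sum_apply, LinearMap.smul_apply, smul_eq_mul,
          Finset.mul_sum]
        rw [Finset.sum_comm]
        exact Finset.sum_congr rfl fun i _ => Finset.sum_congr rfl fun j _ => by ring
      let γ : LinearMap.BilinForm ℝ H := (1 / 2 : ℝ) • (β + β.flip)
      have hγ (f g : H) : γ f g = (β f g + β g f) / 2 := by simp [γ]; ring
      have h1 : γ p p + γ q q + σ p q - σ q p = β p p + β q q + 2 * σ p q := by
        rw [hγ, hγ, ← LinearMap.IsAlt.neg hσ q p]; ring
      have h2 : γ p q - γ q p - σ p p - σ q q = 0 := by rw [hγ, hγ, hσ, hσ]; ring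
      rw [← h1]
      apply Complex.ext
      · rw [Complex.ofReal_re]
        simp only [hp, hq, e, hγ, dotProduct, Matrix.mulVec, ← Finset.sum_add_distrib,
          ← Finset.sum_sub_distrib, Finset.mul_sum, Complex.re_sum]
        refine Finset.sum_congr rfl fun i _ => Finset.sum_congr rfl fun j _ => ?_
        simp
        ring
      · rw [Complex.ofReal_im, ← h2]
        simp only [hp, hq, e, hγ, dotProduct, Matrix.mulVec, ← Finset.sum_sub_distrib, Finset.mul_sum, Complex.im_sum]
        refine Finset.sum_congr rfl fun i _ => Finset.sum_congr rfl fun j _ => ?_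
        simp
        ring
    rw [key, Complex.zero_le_real]
    have h1 := h p q
    have h2 := hβ p
    have h3 := hβ q
    nlinarith [sq_nonneg (β p p - β q q), abs_le_of_sq_le_sq (a := 2 * σ p q) (b := β p p + β q q)
      (by nlinarith [sq_nonneg (β p p - β q q)]) (by positivity)]

/-- The Gaussian kernel is positive semidefinite. -/
theorem posSemidef_gaussian {σ β : LinearMap.BilinForm ℝ H} (hσ : σ.IsAlt)
    (hβ : ∀ f, 0 ≤ β f f) (h : ∀ f g, σ f g ^ 2 ≤ β f f * β g g) (m : H →ₗ[ℝ] ℝ) {n : Type*}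
    [Finite n] (v : n → H) :
    (Matrix.of fun i j => phase (-σ (v i) (v j)) *
      Complex.exp (m (v j - v i) * Complex.I
        - (1 / 2 : ℂ) * β (v j - v i) (v j - v i))).PosSemidef := by
  -- Expanding `β(v j - v i, v j - v i)`, the diagonal terms and the mean give the rank-one factor
  -- `h2`; the cross terms are the symmetrised form in `h1`.
  have h1 := (posSemidef_form hσ hβ h v).hadamard_exp
  have h2 := Matrix.posSemidef_vecMulVec_star_self
    (fun i => Complex.exp (m (v i) * Complex.I - (1 / 2 : ℂ) * β (v i) (v i)))
  refine cast (congrArg _ ?_) (h2.hadamard h1)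
  ext i j
  simp only [Matrix.of_apply, Matrix.hadamard_apply, Matrix.vecMulVec_apply, Pi.star_apply, phase,
    ← Complex.exp_add, RCLike.star_def, ← Complex.exp_conj]
  congr 1
  simp [map_ofNat]
  ring

end Weyl

/-! ### Bounds for positive functionals -/

namespace Weyl

section Growth

variable {H : Type*} [AddCommGroup H] [Module ℝ H]

/-- If `t > s`, the powers of `t / s` outgrow any polynomial in the exponent. -/
theorem le_of_pow_two_pow_le {s t : ℝ} (hs : 0 ≤ s) (d : ℕ)
    (h : ∀ m : ℕ, t ^ 2 ^ m ≤ ((2 ^ m + 1 : ℕ) : ℝ) ^ d * s ^ 2 ^ m) : t ≤ s := by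
  by_contra! hst
  have ht : 0 < t := hs.trans_lt hst
  rcases hs.eq_or_lt with rfl | hs
  · have := h 0
    simp at this
    linarith
  have hr : 1 < t / s := (one_lt_div hs).2 hst
  have h1 := tendsto_pow_const_div_const_pow_of_one_lt d hr
  have h2 : Filter.Tendsto (fun m : ℕ => 2 ^ m) Filter.atTop Filter.atTop :=
    tendsto_pow_atTop_atTop_of_one_lt one_lt_two
  have h3 := (h1.comp h2).const_mul ((2 : ℝ) ^ d)
  rw [mul_zero] at h3
  obtain ⟨m, hm⟩ := (h3.eventually_lt_const one_pos).exists
  have h4 := h m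
  simp only [Function.comp_apply, div_pow] at hm
  have h5 : ((2 ^ m + 1 : ℕ) : ℝ) ^ d ≤ 2 ^ d * ((2 ^ m : ℕ) : ℝ) ^ d := by
    rw [← mul_pow]
    gcongr
    push_cast
    have : (1 : ℝ) ≤ 2 ^ m := one_le_pow₀ one_le_two
    linarith
  have h6 : 0 < t ^ 2 ^ m := by positivity
  have h7 : 0 < s ^ 2 ^ m := by positivity
  rw [div_div_eq_mul_div, ← mul_div_assoc, div_lt_one h6, ← mul_assoc] at hm
  exact absurd (h4.trans (mul_le_mul_of_nonneg_right h5 h7.le)) (not_le.2 hm)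

theorem sum_repr_smul_weylBasis {σ : LinearMap.BilinForm ℝ H} {a : weylSpan σ} {F : Finset H}
    (h : ((weylBasis σ).repr a).support ⊆ F) :
    ∑ f ∈ F, (weylBasis σ).repr a f • weylBasis σ f = a := by
  conv_rhs => rw [← (weylBasis σ).linearCombination_repr a, Finsupp.linearCombination_apply]
  exact (Finsupp.sum_of_support_subset _ h (fun f c => c • weylBasis σ f)
    fun _ _ => zero_smul ℂ _).symm

/-- Cauchy–Schwarz bounds the `ℓ¹` norm of the coefficients by their `ℓ²` norm, and that by the
operator norm. -/
theorem norm_le_sqrt_card_mul {σ : LinearMap.BilinForm ℝ H} {φ : weylSpan σ →ₗ[ℂ] ℂ}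
    (hφ : ∀ f, ‖φ (weylBasis σ f)‖ ≤ 1) (F : Finset H) {a : weylSpan σ}
    (ha : a ∈ Submodule.span ℂ (weylBasis σ '' F)) : ‖φ a‖ ≤ √F.card * ‖(a : CCR σ)‖ := by
  obtain ⟨c, rfl⟩ : ∃ c : H → ℂ, ∑ f ∈ F, c f • weylBasis σ f = a := by
    exact ⟨_, sum_repr_smul_weylBasis (by exact_mod_cast (weylBasis σ).mem_span_image.1 ha)⟩
  have h1 : ‖φ (∑ f ∈ F, c f • weylBasis σ f)‖ ≤ ∑ f ∈ F, ‖c f‖ := by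
    rw [map_sum]
    refine norm_sum_le_of_le _ fun f _ => ?_
    rw [map_smul, smul_eq_mul, norm_mul]
    exact mul_le_of_le_one_right (norm_nonneg _) (hφ f)
  have h2 : ((∑ f ∈ F, c f • weylBasis σ f : weylSpan σ) : CCR σ) = ∑ f ∈ F, c f • W σ f := by
    rw [← weylIncl_apply]
    simp [weylIncl_apply, coe_weylBasis]
  rw [h2]
  refine h1.trans (abs_le_of_sq_le_sq' ?_ (by positivity)).2
  rw [mul_pow, Real.sq_sqrt (by positivity)]
  refine sq_sum_le_card_mul_sum_sq.trans ?_
  gcongr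
  exact sum_norm_sq_le σ F c

/-- The sums of at most `k` copies of each element of `F`. -/
def boxSums [DecidableEq H] (F : Finset H) (k : ℕ) : Finset H :=
  Finset.univ.image fun c : F → Fin (k + 1) => ∑ i, (c i : ℕ) • (i : H)

omit [Module ℝ H] in
theorem card_boxSums_le [DecidableEq H] (F : Finset H) (k : ℕ) :
    (boxSums F k).card ≤ (k + 1) ^ F.card :=
  Finset.card_image_le.trans (by simp)

omit [Module ℝ H] in
theorem add_mem_boxSums [DecidableEq H] {F : Finset H} {k : ℕ} {f g : H} (hf : f ∈ boxSums F k)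
    (hg : g ∈ F) : f + g ∈ boxSums F (k + 1) := by
  simp only [boxSums, Finset.mem_image, Finset.mem_univ, true_and] at hf ⊢
  obtain ⟨c, rfl⟩ := hf
  refine ⟨fun i => ⟨c i + if i = ⟨g, hg⟩ then 1 else 0, ?_⟩, ?_⟩
  · have := (c i).2
    split_ifs <;> omega
  · simp [add_smul, Finset.sum_add_distrib, ite_smul]

theorem pow_mem_span_boxSums [DecidableEq H] {σ : LinearMap.BilinForm ℝ H} {F : Finset H}
    {a : weylSpan σ} (ha : a ∈ Submodule.span ℂ (weylBasis σ '' F)) (k : ℕ) :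
    a ^ k ∈ Submodule.span ℂ (weylBasis σ '' (boxSums F k : Set H)) := by
  induction k with
  | zero =>
    rw [pow_zero, ← weylBasis_zero]
    exact Submodule.subset_span ⟨0, by simp [boxSums], rfl⟩
  | succ k ih =>
    rw [pow_succ]
    have h := Submodule.mul_mem_mul ih ha
    rw [Submodule.span_mul_span] at h
    refine Submodule.span_le.2 ?_ h
    rintro _ ⟨_, ⟨f, hf, rfl⟩, _, ⟨g, hg, rfl⟩, rfl⟩
    simp only [weylBasis_mul]
    exact Submodule.smul_mem _ _ (Submodule.subset_span ⟨_, add_mem_boxSums hf hg, rfl⟩)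

/-- As `H` is commutative, the support of `a ^ k` has at most `(k + 1) ^ d` elements, `d` being the
size of the support of `a`. -/
theorem norm_pow_le {σ : LinearMap.BilinForm ℝ H} {φ : weylSpan σ →ₗ[ℂ] ℂ}
    (hφ : ∀ f, ‖φ (weylBasis σ f)‖ ≤ 1) (a : weylSpan σ) :
    ∃ d : ℕ, ∀ k, ‖φ (a ^ k)‖ ≤ ((k + 1 : ℕ) : ℝ) ^ d * ‖(a : CCR σ)‖ ^ k := by
  classical
  set F := ((weylBasis σ).repr a).support
  have ha : a ∈ Submodule.span ℂ (weylBasis σ '' F) := (weylBasis σ).mem_span_repr_support a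
  refine ⟨F.card, fun k => (norm_le_sqrt_card_mul hφ _ (pow_mem_span_boxSums ha k)).trans ?_⟩
  have h1 : √(boxSums F k).card ≤ ((k + 1 : ℕ) : ℝ) ^ F.card := by
    rw [Real.sqrt_le_iff]
    refine ⟨by positivity, ?_⟩
    calc ((boxSums F k).card : ℝ) ≤ ((k + 1 : ℕ) : ℝ) ^ F.card := by
          exact_mod_cast card_boxSums_le F k
      _ ≤ _ := le_self_pow₀ (one_le_pow₀ (by simp)) two_ne_zero
  have h2 : ‖((a ^ k : weylSpan σ) : CCR σ)‖ ≤ ‖(a : CCR σ)‖ ^ k := by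
    rw [SubmonoidClass.coe_pow]
    rcases subsingleton_or_nontrivial (CCR σ) with _ | _
    · rw [Subsingleton.elim (a : CCR σ) 0]
      rcases k with _ | k
      · rw [Subsingleton.elim ((0 : CCR σ) ^ 0) 0]; simp
      · simp
    · exact _root_.norm_pow_le _ _
  gcongr

/-- A positive functional on the span of the Weyl unitaries that is bounded by `1` on these is
contractive. -/
theorem re_star_mul_self_le {σ : LinearMap.BilinForm ℝ H} {φ : weylSpan σ →ₗ[ℂ] ℂ}
    (hφ : ∀ f, ‖φ (weylBasis σ f)‖ ≤ 1) (hpos : ∀ a, 0 ≤ (φ (star a * a)).re)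
    (a : weylSpan σ) : (φ (star a * a)).re ≤ ‖(a : CCR σ)‖ ^ 2 := by
  have hone : (φ 1).re ≤ 1 := by
    rw [← weylBasis_zero]
    exact (Complex.re_le_norm _).trans (hφ 0)
  -- Cauchy–Schwarz against `1`: positivity at `x - t` with `t = Re φ(x)`, and `Re φ(1) ≤ 1`.
  have hsq (x : weylSpan σ) (hx : star x = x) : (φ x).re ^ 2 ≤ (φ (x ^ 2)).re := by
    set t : ℝ := (φ x).re with ht
    have h1 := hpos (x - (t : ℂ) • 1)
    have h2 : star (x - (t : ℂ) • 1) * (x - (t : ℂ) • 1)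
        = x ^ 2 - ((2 * t : ℝ) : ℂ) • x + ((t ^ 2 : ℝ) : ℂ) • 1 := by
      rw [star_sub, star_smul, hx, star_one, RCLike.star_def, Complex.conj_ofReal, sub_mul,
        mul_sub, mul_sub, smul_mul_smul_comm, mul_smul_comm, smul_mul_assoc]
      push_cast
      rw [mul_one, one_mul, mul_one, sq x]
      module
    rw [h2, map_add, map_sub, map_smul, map_smul, smul_eq_mul, smul_eq_mul, Complex.add_re,
      Complex.sub_re, Complex.re_ofReal_mul, Complex.re_ofReal_mul, ← ht] at h1
    nlinarith [mul_le_mul_of_nonneg_left hone (sq_nonneg t)]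
  set x := star a * a with hx
  have hxs : star x = x := by simp [hx]
  have hiter (m : ℕ) : (φ x).re ^ 2 ^ m ≤ (φ (x ^ 2 ^ m)).re := by
    induction m with
    | zero => simp
    | succ m ih =>
      rw [pow_succ 2 m, pow_mul, pow_mul]
      refine le_trans ?_ (hsq (x ^ 2 ^ m) (by rw [star_pow, hxs]))
      have := hpos a
      gcongr
  obtain ⟨d, hd⟩ := norm_pow_le hφ x
  have hn : ‖(x : CCR σ)‖ = ‖(a : CCR σ)‖ ^ 2 := by
    rw [hx, sq]
    exact CStarRing.norm_star_mul_self (x := (a : CCR σ))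
  rw [← hn]
  exact le_of_pow_two_pow_le (norm_nonneg _) d fun m =>
    (hiter m).trans ((Complex.re_le_norm _).trans (hd _))

end Growth

end Weyl

/-! ### Completely positive maps between Weyl algebras -/

namespace Weyl

section Extension

variable {H₁ H₂ : Type*} [AddCommGroup H₁] [Module ℝ H₁] [AddCommGroup H₂] [Module ℝ H₂]
  {σ₁ : LinearMap.BilinForm ℝ H₁} {σ₂ : LinearMap.BilinForm ℝ H₂} {B : H₁ →ₗ[ℝ] H₂} {b : H₁ → ℂ}

/-- The linear map `W(f) ↦ b(f) W(B f)` on the span of the Weyl unitaries. -/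
def preQuasifree (σ₁ : LinearMap.BilinForm ℝ H₁) (σ₂ : LinearMap.BilinForm ℝ H₂)
    (B : H₁ →ₗ[ℝ] H₂) (b : H₁ → ℂ) : weylSpan σ₁ →ₗ[ℂ] CCR σ₂ :=
  (weylBasis σ₁).constr ℂ fun f => b f • W σ₂ (B f)

theorem preQuasifree_weylBasis (f : H₁) :
    preQuasifree σ₁ σ₂ B b (weylBasis σ₁ f) = b f • W σ₂ (B f) := by
  simp [preQuasifree]

theorem preQuasifree_star (hσ₁ : σ₁.IsAlt) (hσ₂ : σ₂.IsAlt)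
    (hb : ∀ f, b (-f) = starRingEnd ℂ (b f)) (a : weylSpan σ₁) :
    preQuasifree σ₁ σ₂ B b (star a) = star (preQuasifree σ₁ σ₂ B b a) := by
  have ha : a ∈ Submodule.span ℂ (Set.range (weylBasis σ₁)) := by
    rw [Module.Basis.span_eq]; trivial
  induction ha using Submodule.span_induction with
  | mem a ha =>
    obtain ⟨f, rfl⟩ := ha
    rw [star_weylBasis hσ₁, preQuasifree_weylBasis, preQuasifree_weylBasis, star_smul, star_W,
      hσ₂, phase_zero, one_smul, hb, map_neg]
    rfl
  | zero => simp
  | add a a' _ _ ha ha' => simp [ha, ha']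
  | smul c a _ ha => simp [ha]

theorem preQuasifree_star_mul (hσ₁ : σ₁.IsAlt) (hσ₂ : σ₂.IsAlt) (f g : H₁) :
    preQuasifree σ₁ σ₂ B b (star (weylBasis σ₁ f) * weylBasis σ₁ g)
      = (phase (σ₂ (B f) (B g) - σ₁ f g) * b (g - f)) • (star (W σ₂ (B f)) * W σ₂ (B g)) := by
  rw [star_weylBasis_mul hσ₁, star_W_mul_W hσ₂, map_smul, preQuasifree_weylBasis, smul_smul,
    smul_smul, map_sub]
  congr 1
  rw [mul_right_comm, ← phase_add, sub_add_eq_add_sub, add_neg_cancel, zero_sub]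

theorem inner_toOp_star_mul {H : Type*} [AddCommGroup H] [Module ℝ H]
    {σ : LinearMap.BilinForm ℝ H} (a b : CCR σ) (x y : L2 H) :
    ⟪x, toOp σ (star a * b) y⟫_ℂ = ⟪toOp σ a x, toOp σ b y⟫_ℂ := by
  rw [map_mul, map_star, ContinuousLinearMap.star_eq_adjoint]
  change ⟪x, ContinuousLinearMap.adjoint (toOp σ a) (toOp σ b y)⟫_ℂ = _
  rw [ContinuousLinearMap.adjoint_inner_right]

/-- The kernel of `W(f) ↦ b(f) W(B f)` is positive semidefinite. -/
def HasPosKernel (σ₁ : LinearMap.BilinForm ℝ H₁) (σ₂ : LinearMap.BilinForm ℝ H₂)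
    (B : H₁ →ₗ[ℝ] H₂) (b : H₁ → ℂ) : Prop :=
  open scoped ComplexOrder in
  ∀ F : Finset H₁, (Matrix.of fun f g : F =>
    phase (σ₂ (B f) (B g) - σ₁ f g) * b (g - f)).PosSemidef

/-- This is complete positivity on the span: expanding every `a i` over one finite set of Weyl
unitaries gives the positive kernel paired with a Gram matrix. -/
theorem re_sum_inner_preQuasifree_nonneg (hσ₁ : σ₁.IsAlt) (hσ₂ : σ₂.IsAlt)
    (hK : HasPosKernel σ₁ σ₂ B b) {ι : Type*} [Fintype ι] (a : ι → weylSpan σ₁) (ξ : ι → L2 H₂) :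
    0 ≤ (∑ i, ∑ j,
      ⟪ξ i, toOp σ₂ (preQuasifree σ₁ σ₂ B b (star (a i) * a j)) (ξ j)⟫_ℂ).re := by
  classical
  set F : Finset H₁ := Finset.univ.biUnion fun i => ((weylBasis σ₁).repr (a i)).support with hF
  let c (i : ι) (f : F) : ℂ := (weylBasis σ₁).repr (a i) f
  have ha (i : ι) : a i = ∑ f : F, c i f • weylBasis σ₁ f := by
    rw [Finset.sum_coe_sort F fun f => (weylBasis σ₁).repr (a i) f • weylBasis σ₁ f]
    exact (sum_repr_smul_weylBasis (Finset.subset_biUnion_of_mem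
      (fun i => ((weylBasis σ₁).repr (a i)).support) (Finset.mem_univ i))).symm
  have h := (hK F).re_sum_inner_nonneg fun f : F => ∑ i, c i f • toOp σ₂ (W σ₂ (B f)) (ξ i)
  convert h using 2
  have e (i j : ι) : ⟪ξ i, toOp σ₂ (preQuasifree σ₁ σ₂ B b (star (a i) * a j)) (ξ j)⟫_ℂ
      = ∑ f : F, ∑ g : F, (phase (σ₂ (B f) (B g) - σ₁ f g) * b (g - f)) *
        (starRingEnd ℂ (c i f) * (c j g * ⟪toOp σ₂ (W σ₂ (B f)) (ξ i),
          toOp σ₂ (W σ₂ (B g)) (ξ j)⟫_ℂ)) := by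
    rw [ha i, ha j]
    simp only [star_sum, star_smul, Finset.sum_mul, Finset.mul_sum, smul_mul_smul_comm, map_sum,
      map_smul, preQuasifree_star_mul hσ₁ hσ₂, sum_apply, smul_apply, inner_sum,
      inner_smul_right, inner_toOp_star_mul]
    rw [Finset.sum_comm]
    refine Finset.sum_congr rfl fun f _ => Finset.sum_congr rfl fun g _ => ?_
    rw [starRingEnd_apply]
    ring
  simp only [e, sum_inner, inner_sum, inner_smul_left, inner_smul_right, Finset.mul_sum,
    Matrix.of_apply]
  calc _ = ∑ i, ∑ f : F, ∑ g : F, ∑ j, (phase (σ₂ (B f) (B g) - σ₁ f g) * b (g - f)) *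
        (starRingEnd ℂ (c i f) * (c j g * ⟪toOp σ₂ (W σ₂ (B f)) (ξ i),
          toOp σ₂ (W σ₂ (B g)) (ξ j)⟫_ℂ)) := by
        refine Finset.sum_congr rfl fun i _ => ?_
        rw [Finset.sum_comm]
        exact Finset.sum_congr rfl fun f _ => Finset.sum_comm
    _ = _ := by
        rw [Finset.sum_comm]
        refine Finset.sum_congr rfl fun f _ => ?_
        rw [Finset.sum_comm]
        refine Finset.sum_congr rfl fun g _ => ?_
        rw [Finset.sum_comm]
        refine Finset.sum_congr rfl fun i _ => Finset.sum_congr rfl fun j _ => ?_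
        ring

/-- The Schwarz inequality `Φ(a)*Φ(a) ≤ Φ(a*a)` in the vector `ξ`, from positivity for the pair `(1,
a)` at the vectors `(-Φ(a)ξ, ξ)`. -/
theorem norm_sq_preQuasifree_apply_le (hσ₁ : σ₁.IsAlt) (hσ₂ : σ₂.IsAlt)
    (hb : ∀ f, b (-f) = starRingEnd ℂ (b f)) (hb0 : b 0 = 1)
    (hK : HasPosKernel σ₁ σ₂ B b) (a : weylSpan σ₁) (ξ : L2 H₂) :
    ‖toOp σ₂ (preQuasifree σ₁ σ₂ B b a) ξ‖ ^ 2
      ≤ (⟪ξ, toOp σ₂ (preQuasifree σ₁ σ₂ B b (star a * a)) ξ⟫_ℂ).re := by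
  have h := re_sum_inner_preQuasifree_nonneg hσ₁ hσ₂ hK ![1, a]
    ![-toOp σ₂ (preQuasifree σ₁ σ₂ B b a) ξ, ξ]
  have h1 : preQuasifree σ₁ σ₂ B b 1 = 1 := by
    rw [← weylBasis_zero, preQuasifree_weylBasis, hb0, map_zero, W_zero, one_smul]
  set η := toOp σ₂ (preQuasifree σ₁ σ₂ B b a) ξ with hη
  have h2 : ⟪ξ, toOp σ₂ (star (preQuasifree σ₁ σ₂ B b a)) η⟫_ℂ = ⟪η, η⟫_ℂ := by
    have := inner_toOp_star_mul (preQuasifree σ₁ σ₂ B b a) 1 ξ η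
    simpa [hη] using this
  have h3 : (⟪η, η⟫_ℂ).re = ‖η‖ ^ 2 := by
    rw [inner_self_eq_norm_sq_to_K]
    norm_cast
  simp [-inner_self_eq_norm_sq_to_K, Fin.sum_univ_two, h1, preQuasifree_star hσ₁ hσ₂ hb, h2, h3,
    ← hη] at h
  linarith

/-- For a unit vector `ξ` the functional `⟪ξ, Φ(·) ξ⟫` is positive and bounded by `1` on the Weyl
unitaries, so `re_star_mul_self_le` bounds the right side of the Schwarz inequality. -/
theorem norm_preQuasifree_le (hσ₁ : σ₁.IsAlt) (hσ₂ : σ₂.IsAlt)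
    (hb : ∀ f, b (-f) = starRingEnd ℂ (b f)) (hb0 : b 0 = 1) (hb1 : ∀ f, ‖b f‖ ≤ 1)
    (hK : HasPosKernel σ₁ σ₂ B b) (a : weylSpan σ₁) :
    ‖preQuasifree σ₁ σ₂ B b a‖ ≤ 1 * ‖weylIncl σ₁ a‖ := by
  rw [one_mul, weylIncl_apply]
  refine ContinuousLinearMap.opNorm_le_of_unit_norm (𝕜 := ℂ)
    (f := toOp σ₂ (preQuasifree σ₁ σ₂ B b a)) (norm_nonneg _) fun ξ hξ => ?_
  refine (abs_le_of_sq_le_sq' ?_ (norm_nonneg _)).2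
  refine (norm_sq_preQuasifree_apply_le hσ₁ hσ₂ hb hb0 hK a ξ).trans ?_
  let φ : weylSpan σ₁ →ₗ[ℂ] ℂ :=
    { toFun := fun a => ⟪ξ, toOp σ₂ (preQuasifree σ₁ σ₂ B b a) ξ⟫_ℂ
      map_add' := fun a a' => by simp
      map_smul' := fun c a => by simp }
  refine re_star_mul_self_le (φ := φ) (fun f => ?_) (fun a => ?_) a
  · change ‖⟪ξ, toOp σ₂ (preQuasifree σ₁ σ₂ B b (weylBasis σ₁ f)) ξ⟫_ℂ‖ ≤ 1
    refine (norm_inner_le_norm _ _).trans ?_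
    rw [preQuasifree_weylBasis, map_smul, smul_apply, norm_smul, toOp_W,
      LinearIsometry.norm_map, hξ, mul_one, one_mul]
    exact hb1 f
  · have h := re_sum_inner_preQuasifree_nonneg hσ₁ hσ₂ hK (ι := Fin 1) (fun _ => a) fun _ => ξ
    simpa [φ] using h

/-- The extension of `W(f) ↦ b(f) W(B f)` to the Weyl algebra. -/
def quasifree (σ₁ : LinearMap.BilinForm ℝ H₁) (σ₂ : LinearMap.BilinForm ℝ H₂)
    (B : H₁ →ₗ[ℝ] H₂) (b : H₁ → ℂ) : CCR σ₁ →L[ℂ] CCR σ₂ :=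
  (preQuasifree σ₁ σ₂ B b).extendOfNorm (weylIncl σ₁)

theorem quasifree_coe (hσ₁ : σ₁.IsAlt) (hσ₂ : σ₂.IsAlt)
    (hb : ∀ f, b (-f) = starRingEnd ℂ (b f)) (hb0 : b 0 = 1) (hb1 : ∀ f, ‖b f‖ ≤ 1)
    (hK : HasPosKernel σ₁ σ₂ B b) (a : weylSpan σ₁) :
    quasifree σ₁ σ₂ B b a = preQuasifree σ₁ σ₂ B b a :=
  LinearMap.extendOfNorm_eq (denseRange_weylIncl σ₁)
    ⟨1, norm_preQuasifree_le hσ₁ hσ₂ hb hb0 hb1 hK⟩ a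

theorem quasifree_W (hσ₁ : σ₁.IsAlt) (hσ₂ : σ₂.IsAlt)
    (hb : ∀ f, b (-f) = starRingEnd ℂ (b f)) (hb0 : b 0 = 1) (hb1 : ∀ f, ‖b f‖ ≤ 1)
    (hK : HasPosKernel σ₁ σ₂ B b) (f : H₁) :
    quasifree σ₁ σ₂ B b (W σ₁ f) = b f • W σ₂ (B f) := by
  rw [← coe_weylBasis, quasifree_coe hσ₁ hσ₂ hb hb0 hb1 hK, preQuasifree_weylBasis]

theorem norm_quasifree_apply_le (hσ₁ : σ₁.IsAlt) (hσ₂ : σ₂.IsAlt)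
    (hb : ∀ f, b (-f) = starRingEnd ℂ (b f)) (hb0 : b 0 = 1) (hb1 : ∀ f, ‖b f‖ ≤ 1)
    (hK : HasPosKernel σ₁ σ₂ B b) (a : CCR σ₁) : ‖quasifree σ₁ σ₂ B b a‖ ≤ ‖a‖ := by
  simpa [quasifree] using LinearMap.norm_extendOfNorm_apply_le (denseRange_weylIncl σ₁) 1
    (norm_preQuasifree_le hσ₁ hσ₂ hb hb0 hb1 hK) a

theorem quasifree_star (hσ₁ : σ₁.IsAlt) (hσ₂ : σ₂.IsAlt)
    (hb : ∀ f, b (-f) = starRingEnd ℂ (b f)) (hb0 : b 0 = 1) (hb1 : ∀ f, ‖b f‖ ≤ 1)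
    (hK : HasPosKernel σ₁ σ₂ B b) (a : CCR σ₁) :
    quasifree σ₁ σ₂ B b (star a) = star (quasifree σ₁ σ₂ B b a) := by
  refine (denseRange_weylIncl σ₁).induction_on a
    (isClosed_eq (by fun_prop) (by fun_prop)) fun a => ?_
  rw [weylIncl_apply, ← StarMemClass.coe_star, quasifree_coe hσ₁ hσ₂ hb hb0 hb1 hK,
    quasifree_coe hσ₁ hσ₂ hb hb0 hb1 hK, preQuasifree_star hσ₁ hσ₂ hb]

theorem re_sum_inner_quasifree_nonneg (hσ₁ : σ₁.IsAlt) (hσ₂ : σ₂.IsAlt)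
    (hb : ∀ f, b (-f) = starRingEnd ℂ (b f)) (hb0 : b 0 = 1) (hb1 : ∀ f, ‖b f‖ ≤ 1)
    (hK : HasPosKernel σ₁ σ₂ B b) {ι : Type*} [Fintype ι] (a : ι → CCR σ₁) (ξ : ι → L2 H₂) :
    0 ≤ (∑ i, ∑ j, ⟪ξ i, toOp σ₂ (quasifree σ₁ σ₂ B b (star (a i) * a j)) (ξ j)⟫_ℂ).re := by
  have hd : DenseRange (Pi.map fun (_ : ι) => weylIncl σ₁) :=
    .piMap fun _ => denseRange_weylIncl σ₁
  have hop : Continuous (toOp σ₂) := (isometry_toOp σ₂).continuous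
  refine hd.induction_on a (isClosed_le continuous_const ?_) fun a => ?_
  · refine Complex.continuous_re.comp <| continuous_finsetSum _ fun i _ =>
      continuous_finsetSum _ fun j _ => continuous_const.inner ?_
    have h : Continuous fun a : ι → CCR σ₁ => toOp σ₂ (quasifree σ₁ σ₂ B b (star (a i) * a j)) :=
      hop.comp (by fun_prop)
    exact h.clm_apply continuous_const
  · refine (re_sum_inner_preQuasifree_nonneg hσ₁ hσ₂ hK a ξ).trans_eq ?_
    simp only [← quasifree_coe hσ₁ hσ₂ hb hb0 hb1 hK]
    rfl

end Extension

end Weyl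

/-! ### Positivity of matrices over the Weyl algebra. -/

namespace Weyl

theorem exists_eq_star_mul_self {A : Type*} [NonUnitalCStarAlgebra A] [PartialOrder A]
    [StarOrderedRing A] {a : A} (ha : 0 ≤ a) : ∃ b, a = star b * b :=
  CStarAlgebra.nonneg_iff_eq_star_mul_self.1 ha

/-- Compressing `a` by its negative part `b` gives `-b³`, which the hypothesis forces to vanish.
This criterion is purely algebraic, so positivity can be tested through a faithful action on vectors
without comparing norms. -/
theorem nonneg_of_forall_mul_mul_eq_neg {A : Type*} [NonUnitalCStarAlgebra A] [PartialOrder A]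
    [StarOrderedRing A] {a : A} (ha : IsSelfAdjoint a)
    (h : ∀ b c : A, star b * a * b = -(star c * c) → c = 0) : 0 ≤ a := by
  set b := a⁻ with hb
  have hb0 : 0 ≤ b := CFC.negPart_nonneg a
  have hbs : star b = b := (IsSelfAdjoint.of_nonneg hb0).star_eq
  have h1 : b * a * b = -(b * b * b) := by
    conv_lhs => rw [← CFC.posPart_sub_negPart a ha, mul_sub, ← hb, hb, CFC.negPart_mul_posPart]
    rw [zero_sub, neg_mul]
  obtain ⟨r, hr⟩ := exists_eq_star_mul_self hb0
  have hc : b * b * b = star (r * b) * (r * b) := by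
    rw [star_mul, hbs, mul_assoc, mul_assoc, ← mul_assoc (star r), ← hr]
  have hc0 := h b (r * b) (by rw [hbs, h1, hc])
  rw [hc0, mul_zero] at hc
  have h2 : b * b = 0 := by
    refine CStarRing.star_mul_self_eq_zero_iff (b * b) |>.1 ?_
    rw [star_mul, hbs, ← mul_assoc, hc, zero_mul]
  have h3 : b = 0 := by
    refine CStarRing.star_mul_self_eq_zero_iff b |>.1 ?_
    rw [hbs, h2]
  exact (CFC.negPart_eq_zero_iff a ha).1 h3

section MatrixOrder

variable {H : Type*} [AddCommGroup H] [Module ℝ H] {σ : LinearMap.BilinForm ℝ H} {ι : Type*}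
  [Fintype ι]

/-- The action of a matrix over `CCR(H, σ)` on tuples of vectors of `ℓ²(H)`. -/
def matrixAct (M : CStarMatrix ι ι (CCR σ)) (ξ : ι → L2 H) (i : ι) : L2 H :=
  ∑ j, toOp σ (M i j) (ξ j)

theorem matrixAct_mul (M N : CStarMatrix ι ι (CCR σ)) (ξ : ι → L2 H) :
    matrixAct (M * N) ξ = matrixAct M (matrixAct N ξ) := by
  ext1 i
  simp only [matrixAct, CStarMatrix.mul_apply, map_sum, map_mul, sum_apply]
  rw [Finset.sum_comm]
  rfl

theorem sum_inner_matrixAct_star (M : CStarMatrix ι ι (CCR σ)) (ξ η : ι → L2 H) :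
    ∑ i, ⟪ξ i, matrixAct (star M) η i⟫_ℂ = ∑ i, ⟪matrixAct M ξ i, η i⟫_ℂ := by
  simp only [matrixAct, inner_sum, sum_inner]
  rw [Finset.sum_comm]
  refine Finset.sum_congr rfl fun i _ => Finset.sum_congr rfl fun j _ => ?_
  have := inner_toOp_star_mul (M i j) 1 (ξ j) (η i)
  rw [CStarMatrix.star_apply]
  simpa using this

theorem eq_zero_of_matrixAct_eq_zero {M : CStarMatrix ι ι (CCR σ)}
    (h : ∀ ξ, matrixAct M ξ = 0) : M = 0 := by
  classical
  refine CStarMatrix.ext fun i j => (isometry_toOp σ).injective ?_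
  rw [CStarMatrix.zero_apply, map_zero]
  ext1 x
  have := congrFun (h (Pi.single j x)) i
  rw [matrixAct, Finset.sum_eq_single j (fun k _ hk => by simp [Pi.single_eq_of_ne hk]) (by simp),
    Pi.single_eq_same] at this
  exact this

/-- If `N* M N = -Q* Q`, then `∑ ‖(Qξ) i‖² ≤ 0` for every `ξ`, so `Q` acts as zero and is zero. -/
theorem matrix_nonneg_of_re_nonneg {M : CStarMatrix ι ι (CCR σ)} (hM : IsSelfAdjoint M)
    (h : ∀ ξ, 0 ≤ (∑ i, ⟪ξ i, matrixAct M ξ i⟫_ℂ).re) : 0 ≤ M := by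
  refine nonneg_of_forall_mul_mul_eq_neg hM fun N Q hQ => eq_zero_of_matrixAct_eq_zero fun ξ => ?_
  have e1 : ∑ i, ⟪ξ i, matrixAct (star Q * Q) ξ i⟫_ℂ
      = ∑ i, ⟪matrixAct Q ξ i, matrixAct Q ξ i⟫_ℂ := by
    rw [matrixAct_mul, sum_inner_matrixAct_star]
  have e2 : ∑ i, ⟪ξ i, matrixAct (star N * M * N) ξ i⟫_ℂ
      = ∑ i, ⟪matrixAct N ξ i, matrixAct M (matrixAct N ξ) i⟫_ℂ := by
    rw [mul_assoc, matrixAct_mul, sum_inner_matrixAct_star, matrixAct_mul M]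
  have e3 : ∑ i, ⟪ξ i, matrixAct (star N * M * N) ξ i⟫_ℂ
      = -∑ i, ⟪ξ i, matrixAct (star Q * Q) ξ i⟫_ℂ := by
    rw [hQ]
    simp only [matrixAct, CStarMatrix.neg_apply, map_neg, neg_apply, Finset.sum_neg_distrib,
      inner_neg_right]
  have e4 := h (matrixAct N ξ)
  rw [← e2, e3, e1, Complex.neg_re, Complex.re_sum] at e4
  have e5 : ∀ i ∈ Finset.univ, 0 ≤ (⟪matrixAct Q ξ i, matrixAct Q ξ i⟫_ℂ).re :=
    fun i _ => inner_self_nonneg (𝕜 := ℂ)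
  have e6 := (Finset.sum_eq_zero_iff_of_nonneg e5).1
    (le_antisymm (by linarith) (Finset.sum_nonneg e5))
  ext1 i
  exact inner_self_eq_zero (𝕜 := ℂ).1 (Complex.ext (e6 i (Finset.mem_univ i))
    (inner_self_im (𝕜 := ℂ) _))

end MatrixOrder

/-! ### Complete positivity of quasifree maps, and Gaussian states. -/

section CompletelyPositive

variable {H₁ H₂ : Type*} [AddCommGroup H₁] [Module ℝ H₁] [AddCommGroup H₂] [Module ℝ H₂]
  {σ₁ : LinearMap.BilinForm ℝ H₁} {σ₂ : LinearMap.BilinForm ℝ H₂} {B : H₁ →ₗ[ℝ] H₂} {b : H₁ → ℂ}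

theorem map_quasifree_nonneg (hσ₁ : σ₁.IsAlt) (hσ₂ : σ₂.IsAlt)
    (hb : ∀ f, b (-f) = starRingEnd ℂ (b f)) (hb0 : b 0 = 1) (hb1 : ∀ f, ‖b f‖ ≤ 1)
    (hK : HasPosKernel σ₁ σ₂ B b) {ι : Type*} [Fintype ι] {M : CStarMatrix ι ι (CCR σ₁)}
    (hM : 0 ≤ M) : 0 ≤ M.map (quasifree σ₁ σ₂ B b) := by
  refine matrix_nonneg_of_re_nonneg ?_ fun ξ => ?_
  · refine CStarMatrix.ext fun i j => ?_
    rw [CStarMatrix.star_apply, CStarMatrix.map_apply, CStarMatrix.map_apply,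
      ← quasifree_star hσ₁ hσ₂ hb hb0 hb1 hK, CStarMatrix.star_apply_of_isSelfAdjoint
      (IsSelfAdjoint.of_nonneg hM)]
  · obtain ⟨N, rfl⟩ := exists_eq_star_mul_self hM
    have e : ∑ i, ⟪ξ i, matrixAct ((star N * N).map (quasifree σ₁ σ₂ B b)) ξ i⟫_ℂ
        = ∑ k, ∑ i, ∑ j, ⟪ξ i, toOp σ₂ (quasifree σ₁ σ₂ B b (star (N k i) * N k j)) (ξ j)⟫_ℂ := by
      simp only [matrixAct, CStarMatrix.map_apply, CStarMatrix.mul_apply, CStarMatrix.star_apply,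
        map_sum, sum_apply, inner_sum]
      rw [Finset.sum_comm (s := Finset.univ (α := ι))]
      conv_rhs => rw [Finset.sum_comm]
      rw [Finset.sum_comm]
      exact Finset.sum_congr rfl fun i _ => Finset.sum_comm
    rw [e, Complex.re_sum]
    exact Finset.sum_nonneg fun k _ =>
      re_sum_inner_quasifree_nonneg hσ₁ hσ₂ hb hb0 hb1 hK (N k) ξ

/-- Quasifree maps between Weyl algebras: if the form `σ₁ - σ₂ ∘ B` is dominated by `β`, then
`W(f) ↦ exp(i m(f) - β(f,f)/2) W(B f)` extends to a contractive completely positive map. -/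
theorem exists_quasifree (hσ₁ : σ₁.IsAlt) (hσ₂ : σ₂.IsAlt) (B : H₁ →ₗ[ℝ] H₂) (m : H₁ →ₗ[ℝ] ℝ)
    (β : LinearMap.BilinForm ℝ H₁) (hβ : ∀ f, 0 ≤ β f f)
    (h : ∀ f g, (σ₁ f g - σ₂ (B f) (B g)) ^ 2 ≤ β f f * β g g) :
    ∃ S : CompletelyPositiveMap (CCR σ₁) (CCR σ₂), (∀ a, ‖S a‖ ≤ ‖a‖) ∧
      ∀ f, S (W σ₁ f) = Complex.exp (m f * Complex.I - (1 / 2 : ℂ) * β f f) • W σ₂ (B f) := by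
  set b : H₁ → ℂ := fun f => Complex.exp (m f * Complex.I - (1 / 2 : ℂ) * β f f) with hb_def
  have hb (f : H₁) : b (-f) = starRingEnd ℂ (b f) := by
    simp [hb_def, ← Complex.exp_conj, map_ofNat]
  have hb0 : b 0 = 1 := by simp [hb_def]
  have hb1 (f : H₁) : ‖b f‖ ≤ 1 := by
    rw [hb_def, Complex.norm_exp, Real.exp_le_one_iff]
    have := hβ f
    simp
    linarith
  have hK : HasPosKernel σ₁ σ₂ B b := fun F => by
    -- The Gaussian kernel is used for the defect form `σ₁ - σ₂ ∘ B`.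
    have hσ : (σ₁ - σ₂.compl₁₂ B B).IsAlt := fun f => by simp [hσ₁ f, hσ₂ (B f)]
    refine cast (congrArg _ ?_) (posSemidef_gaussian hσ hβ (fun f g => by simpa using h f g) m
      (fun f : F => (f : H₁)))
    ext f g
    simp [hb_def]
  exact ⟨{ (quasifree σ₁ σ₂ B b).toLinearMap with
    map_cstarMatrix_nonneg' := fun k M hM => map_quasifree_nonneg hσ₁ hσ₂ hb hb0 hb1 hK hM },
    norm_quasifree_apply_le hσ₁ hσ₂ hb hb0 hb1 hK, quasifree_W hσ₁ hσ₂ hb hb0 hb1 hK⟩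

theorem isCoarseGraining_of_map_one {A B : Type*} [CStarAlgebra A] [PartialOrder A]
    [StarOrderedRing A] [CStarAlgebra B] [PartialOrder B] [StarOrderedRing B]
    (T : CompletelyPositiveMap A B) (h : T 1 = 1) : IsCoarseGraining T.toLinearMap :=
  ⟨h, fun M hM => T.map_cstarMatrix_nonneg' 2 M hM⟩

theorem continuous_completelyPositiveMap {A B : Type*} [CStarAlgebra A] [PartialOrder A]
    [StarOrderedRing A] [CStarAlgebra B] [PartialOrder B] [StarOrderedRing B]
    (T : CompletelyPositiveMap A B) : Continuous T :=
  map_continuous T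

theorem completelyPositiveMap_ext_W {S T : CompletelyPositiveMap (CCR σ₁) (CCR σ₂)}
    (h : ∀ f, S (W σ₁ f) = T (W σ₁ f)) : S = T := by
  have := ext_W (S := S.toLinearMap) (T := T.toLinearMap) (continuous_completelyPositiveMap S)
    (continuous_completelyPositiveMap T) h
  exact DFunLike.ext _ _ (LinearMap.congr_fun this)

/-- Gaussian states exist and are unique. -/
theorem existsUnique_isState (hσ₁ : σ₁.IsAlt) (m : H₁ →ₗ[ℝ] ℝ)
    (β : LinearMap.BilinForm ℝ H₁) (hβ : ∀ f, 0 ≤ β f f)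
    (h : ∀ f g, σ₁ f g ^ 2 ≤ β f f * β g g) :
    ∃! φ : CCR σ₁ →L[ℂ] ℂ, IsState φ ∧
      ∀ f, φ (W σ₁ f) = Complex.exp (m f * Complex.I - (1 / 2 : ℂ) * β f f) := by
  -- With `B = 0` the map takes scalar values on the Weyl unitaries; the vector state of `δ₀` reads
  -- them off.
  obtain ⟨S, hS, hSW⟩ := exists_quasifree hσ₁ hσ₁ (0 : H₁ →ₗ[ℝ] H₁) m β hβ (by simpa using h)
  have hvac : ⟪vac H₁, vac H₁⟫_ℂ = 1 := by
    rw [inner_self_eq_norm_sq_to_K, norm_vac]; simp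
  have hle (a : CCR σ₁) : ‖⟪vac H₁, toOp σ₁ (S a) (vac H₁)⟫_ℂ‖ ≤ 1 * ‖a‖ := by
    refine (norm_inner_le_norm _ _).trans ?_
    rw [norm_vac]
    gcongr
    refine ((toOp σ₁ (S a)).le_opNorm _).trans ?_
    rw [norm_vac, mul_one]
    exact hS a
  let φ : CCR σ₁ →L[ℂ] ℂ := LinearMap.mkContinuous
    { toFun := fun a => ⟪vac H₁, toOp σ₁ (S a) (vac H₁)⟫_ℂ
      map_add' := fun a a' => by simp
      map_smul' := fun c a => by simp } 1 hle
  have hφW (f : H₁) : φ (W σ₁ f) = Complex.exp (m f * Complex.I - (1 / 2 : ℂ) * β f f) := by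
    change ⟪vac H₁, toOp σ₁ (S (W σ₁ f)) (vac H₁)⟫_ℂ = _
    rw [hSW, LinearMap.zero_apply, W_zero, map_smul, map_one, smul_apply, inner_smul_right]
    change _ * ⟪vac H₁, vac H₁⟫_ℂ = _
    rw [hvac, mul_one]
  have hφ1 : φ 1 = 1 := by rw [← W_zero, hφW]; simp
  refine ⟨φ, ⟨⟨hφ1, le_antisymm (LinearMap.mkContinuous_norm_le _ zero_le_one _) ?_⟩, hφW⟩,
    fun ψ hψ => ?_⟩
  · have h1 := φ.le_opNorm 1
    have h2 : ‖(1 : CCR σ₁)‖ ≤ 1 := by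
      change ‖ContinuousLinearMap.id ℂ (L2 H₁)‖ ≤ 1
      exact ContinuousLinearMap.norm_id_le
    rw [hφ1, norm_one] at h1
    nlinarith [norm_nonneg φ]
  · have := ext_W (S := ψ.toLinearMap) (T := φ.toLinearMap) ψ.continuous φ.continuous
      fun f => (hψ.2 f).trans (hφW f).symm
    exact ContinuousLinearMap.ext (LinearMap.congr_fun this)

end CompletelyPositive

/-! ### The diagonal of the direct sum and its complement. -/

section DirectSum

variable {H : Type*} [AddCommGroup H] [Module ℝ H] (n : ℕ)

theorem directSumForm_isAlt {σ : LinearMap.BilinForm ℝ H} (hσ : σ.IsAlt) :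
    (directSumForm σ n).IsAlt := fun f => by simp [directSumForm_apply, hσ _]

variable {n} in
theorem directSumForm_self_nonneg {α : LinearMap.BilinForm ℝ H} (hα : ∀ f, 0 ≤ α f f)
    (f : Fin n → H) : 0 ≤ directSumForm α n f f := by
  rw [directSumForm_apply]
  exact Finset.sum_nonneg fun i _ => hα _

variable {n} in
theorem directSumForm_sq_le {σ α : LinearMap.BilinForm ℝ H} (hα : ∀ f, 0 ≤ α f f)
    (h : ∀ f g, σ f g ^ 2 ≤ α f f * α g g) (f g : Fin n → H) :
    directSumForm σ n f g ^ 2 ≤ directSumForm α n f f * directSumForm α n g g := by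
  simp only [directSumForm_apply]
  exact Finset.sum_sq_le_sum_mul_sum_of_sq_le_mul _ (fun i _ => hα _) (fun i _ => hα _)
    fun i _ => h _ _

/-- The embedding `f ↦ n^{-1/2} (f ⊕ ⋯ ⊕ f)`. -/
def diagEmb (H : Type*) [AddCommGroup H] [Module ℝ H] (n : ℕ) : H →ₗ[ℝ] (Fin n → H) :=
  (√(n : ℝ))⁻¹ • LinearMap.pi fun _ => LinearMap.id

theorem diagEmb_apply (f : H) : diagEmb H n f = (√(n : ℝ))⁻¹ • fun _ : Fin n => f := rfl

/-- The map `f₁ ⊕ ⋯ ⊕ fₙ ↦ n^{-1/2} ∑ fᵢ`. -/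
def normSum (H : Type*) [AddCommGroup H] [Module ℝ H] (n : ℕ) : (Fin n → H) →ₗ[ℝ] H :=
  (√(n : ℝ))⁻¹ • ∑ i, LinearMap.proj i

theorem normSum_apply (f : Fin n → H) : normSum H n f = (√(n : ℝ))⁻¹ • ∑ i, f i := by
  simp [normSum, LinearMap.sum_apply]

/-- The map `f₁ ⊕ ⋯ ⊕ fₙ ↦ (f₁ - f) ⊕ ⋯ ⊕ (fₙ - f)` with `f` the mean of the `fᵢ`. -/
def center (H : Type*) [AddCommGroup H] [Module ℝ H] (n : ℕ) : (Fin n → H) →ₗ[ℝ] (Fin n → H) :=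
  LinearMap.id - diagEmb H n ∘ₗ normSum H n

variable {n}

theorem sqrt_inv_mul_sqrt_inv : (√(n : ℝ))⁻¹ * (√(n : ℝ))⁻¹ = (n : ℝ)⁻¹ := by
  rw [← mul_inv, Real.mul_self_sqrt n.cast_nonneg]

theorem directSumForm_diagEmb (hn : 1 ≤ n) (σ : LinearMap.BilinForm ℝ H) (f g : H) :
    directSumForm σ n (diagEmb H n f) (diagEmb H n g) = σ f g := by
  have hn' : (n : ℝ) ≠ 0 := by positivity
  simp only [directSumForm_apply, diagEmb_apply, map_smul, LinearMap.smul_apply,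
    smul_eq_mul, Finset.sum_const, Finset.card_univ, Fintype.card_fin, nsmul_eq_mul]
  rw [← mul_assoc, ← mul_assoc, sqrt_inv_mul_sqrt_inv, inv_mul_cancel₀ hn', one_mul]

/-- `diagEmb` preserves the forms and `normSum` is its adjoint on both sides, so the cross terms
combine. Valid for every bilinear form, this serves for `σ` and `α` alike. -/
theorem directSumForm_center (hn : 1 ≤ n) (σ : LinearMap.BilinForm ℝ H) (f g : Fin n → H) :
    directSumForm σ n (center H n f) (center H n g)
      = directSumForm σ n f g - σ (normSum H n f) (normSum H n g) := by
  have h1 (f : H) (g : Fin n → H) : directSumForm σ n (diagEmb H n f) g = σ f (normSum H n g) := by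
    simp [directSumForm_apply, diagEmb_apply, normSum_apply, Finset.mul_sum]
  have h2 (f : Fin n → H) (g : H) : directSumForm σ n f (diagEmb H n g) = σ (normSum H n f) g := by
    simp [directSumForm_apply, diagEmb_apply, normSum_apply, Finset.mul_sum, LinearMap.sum_apply]
  simp only [center, LinearMap.sub_apply, LinearMap.id_apply, LinearMap.comp_apply, map_sub,
    directSumForm_diagEmb hn, h1, h2]
  ring

end DirectSum

end Weyl

end

/-! ### Product states, recovery and sufficiency. -/

namespace Weyl

variable {H : Type*} [AddCommGroup H] [Module ℝ H] {σ α : LinearMap.BilinForm ℝ H} {n : ℕ}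

/-- Means and variances add in the exponent; existence and uniqueness of product states thus reduce
to the Gaussian case. -/
theorem isProductState_gaussian_iff {m : H →ₗ[ℝ] ℝ} {φ : CCR σ →L[ℂ] ℂ}
    (hφ : IsGaussianState σ α m φ) {ψ : CCR (directSumForm σ n) →L[ℂ] ℂ} :
    IsProductState σ (fun _ => φ) ψ ↔
      IsGaussianState (directSumForm σ n) (directSumForm α n) (∑ i, m ∘ₗ LinearMap.proj i) ψ := by
  refine and_congr_right fun _ => forall_congr' fun f => ?_
  have e : ∏ i, φ (W σ (f i)) = Complex.exp
      (((∑ i, m ∘ₗ LinearMap.proj i : (Fin n → H) →ₗ[ℝ] ℝ) f : ℝ) * Complex.I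
        - (1 / 2 : ℂ) * (directSumForm α n f f : ℝ)) := by
    simp only [hφ.2, ← Complex.exp_sum, Finset.sum_sub_distrib, ← Finset.sum_mul,
      ← Finset.mul_sum, directSumForm_apply, LinearMap.sum_apply, LinearMap.comp_apply,
      LinearMap.proj_apply, Complex.ofReal_sum]
  rw [e]

/-- The recovery map for the quasifree embedding of `CCR(H)` into `CCR(H ⊕ ⋯ ⊕ H)`. -/
theorem exists_recovery_map (hσ : σ.IsAlt) (hα_nonneg : ∀ f, 0 ≤ α f f)
    (hα : ∀ f g, σ f g ^ 2 ≤ α f f * α g g) (hn : 1 ≤ n) :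
    ∃ S : CompletelyPositiveMap (CCR (directSumForm σ n)) (CCR σ),
      ∀ f : Fin n → H, S (W (directSumForm σ n) f) =
        Complex.exp (((1 / (2 * n) * α (∑ i, f i) (∑ i, f i)
          - 1 / 2 * ∑ i, α (f i) (f i) : ℝ)) : ℂ) • W σ ((√(n : ℝ))⁻¹ • ∑ i, f i) := by
  -- The variance is that of the centred vectors: it dominates the defect form and equals `∑
  -- α(fᵢ,fᵢ) - α(∑ fᵢ, ∑ fᵢ) / n`.
  obtain ⟨S, -, hS⟩ := exists_quasifree (directSumForm_isAlt n hσ) hσ (normSum H n) 0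
    ((directSumForm α n).compl₁₂ (center H n) (center H n))
    (fun f => by simpa using directSumForm_self_nonneg hα_nonneg (center H n f)) fun f g => by
      rw [← directSumForm_center hn]
      simpa using directSumForm_sq_le hα_nonneg hα (center H n f) (center H n g)
  refine ⟨S, fun f => ?_⟩
  rw [hS, normSum_apply]
  congr 2
  rw [LinearMap.compl₁₂_apply, directSumForm_center hn, normSum_apply, directSumForm_apply,
    map_smul, map_smul, LinearMap.smul_apply, smul_smul, sqrt_inv_mul_sqrt_inv, smul_eq_mul,
    LinearMap.zero_apply]
  push_cast
  have hn' : (n : ℂ) ≠ 0 := by exact_mod_cast (by omega : n ≠ 0)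
  field_simp
  ring

end Weyl

theorem mainTheorem5 {H : Type*} [AddCommGroup H] [Module ℝ H]
    (σ : LinearMap.BilinForm ℝ H) (hσ_alt : σ.IsAlt) (hσ_nondeg : σ.Nondegenerate)
    (α : LinearMap.BilinForm ℝ H) (hα_nonneg : ∀ f, 0 ≤ α f f)
    (hα : ∀ f g, σ f g ^ 2 ≤ α f f * α g g)
    (n : ℕ) (hn : 1 ≤ n) :
    -- the Gaussian states, their products and the quasifree map `T` exist
    (∀ m : H →ₗ[ℝ] ℝ, ∃! φ : Weyl.CCR σ →L[ℂ] ℂ, Weyl.IsGaussianState σ α m φ) ∧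
    (∀ (m : H →ₗ[ℝ] ℝ) (φ : Weyl.CCR σ →L[ℂ] ℂ), Weyl.IsGaussianState σ α m φ →
      ∃! ψ : Weyl.CCR (Weyl.directSumForm σ n) →L[ℂ] ℂ,
        Weyl.IsProductState σ (fun _ : Fin n => φ) ψ) ∧
    (∃! T : CompletelyPositiveMap (Weyl.CCR σ) (Weyl.CCR (Weyl.directSumForm σ n)),
      ∀ f, T (Weyl.W σ f) =
        Weyl.W (Weyl.directSumForm σ n) ((√(n : ℝ))⁻¹ • fun _ : Fin n => f)) ∧
    -- `T` is a sufficient coarse-graining for the family `ψ m`, and so is shown by the map `S`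
    ∀ (T : CompletelyPositiveMap (Weyl.CCR σ) (Weyl.CCR (Weyl.directSumForm σ n)))
      (φ : (H →ₗ[ℝ] ℝ) → Weyl.CCR σ →L[ℂ] ℂ)
      (ψ : (H →ₗ[ℝ] ℝ) → Weyl.CCR (Weyl.directSumForm σ n) →L[ℂ] ℂ),
      (∀ f, T (Weyl.W σ f) =
        Weyl.W (Weyl.directSumForm σ n) ((√(n : ℝ))⁻¹ • fun _ : Fin n => f)) →
      (∀ m, Weyl.IsGaussianState σ α m (φ m)) →
      (∀ m, Weyl.IsProductState σ (fun _ : Fin n => φ m) (ψ m)) →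
      Weyl.IsSufficient T.toLinearMap ψ ∧
      ∃ S : CompletelyPositiveMap (Weyl.CCR (Weyl.directSumForm σ n)) (Weyl.CCR σ),
        Weyl.IsCoarseGraining S.toLinearMap ∧
        (∀ f : Fin n → H, S (Weyl.W (Weyl.directSumForm σ n) f) =
          Complex.exp (((1 / (2 * n) * α (∑ i, f i) (∑ i, f i)
            - 1 / 2 * ∑ i, α (f i) (f i) : ℝ)) : ℂ) •
            Weyl.W σ ((√(n : ℝ))⁻¹ • ∑ i, f i)) ∧
        ∀ m a, ψ m (T (S a)) = ψ m a := by
  have hτ := Weyl.directSumForm_isAlt n hσ_alt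
  refine ⟨fun m => Weyl.existsUnique_isState hσ_alt m α hα_nonneg hα, fun m φ hφ => ?_, ?_, ?_⟩
  · exact (existsUnique_congr fun ψ => Weyl.isProductState_gaussian_iff hφ).2
      (Weyl.existsUnique_isState hτ _ _ (Weyl.directSumForm_self_nonneg hα_nonneg)
        (Weyl.directSumForm_sq_le hα_nonneg hα))
  -- The diagonal embedding is symplectic, so the defect form vanishes and no Gaussian damping is
  -- needed.
  · obtain ⟨T, -, hT⟩ := Weyl.exists_quasifree hσ_alt hτ (Weyl.diagEmb H n) 0 0 (by simp)
      fun f g => by simp [Weyl.directSumForm_diagEmb hn]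
    have hT' : ∀ f, T (Weyl.W σ f) =
        Weyl.W (Weyl.directSumForm σ n) ((√(n : ℝ))⁻¹ • fun _ : Fin n => f) := fun f => by
      rw [hT, ← Weyl.diagEmb_apply]
      simp
    exact ⟨T, hT', fun T' hT'' =>
      Weyl.completelyPositiveMap_ext_W fun f => (hT'' f).trans (hT' f).symm⟩
  · intro T φ ψ hT hφ hψ
    obtain ⟨S, hS⟩ := Weyl.exists_recovery_map hσ_alt hα_nonneg hα hn
    have hn' : (n : ℝ) ≠ 0 := by positivity
    have hT1 : T 1 = 1 := by
      rw [← Weyl.W_zero, hT, ← Weyl.diagEmb_apply, map_zero, Weyl.W_zero]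
    have hS1 : S 1 = 1 := by
      rw [← Weyl.W_zero, hS, ← Weyl.normSum_apply, map_zero, Weyl.W_zero]
      simp
    have hST (m : H →ₗ[ℝ] ℝ) (a : Weyl.CCR (Weyl.directSumForm σ n)) :
        ψ m (T (S a)) = ψ m a := by
      refine LinearMap.congr_fun (Weyl.ext_W
        (S := (ψ m).toLinearMap ∘ₗ T.toLinearMap ∘ₗ S.toLinearMap) (T := (ψ m).toLinearMap)
        ((ψ m).continuous.comp ((Weyl.continuous_completelyPositiveMap T).comp
          (Weyl.continuous_completelyPositiveMap S))) (ψ m).continuous fun f => ?_) a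
      change ψ m (T (S (Weyl.W _ f))) = ψ m (Weyl.W _ f)
      have hG := ((Weyl.isProductState_gaussian_iff (hφ m)).1 (hψ m)).2
      rw [hS, map_smul, hT, map_smul, ← Weyl.diagEmb_apply, ← Weyl.normSum_apply, hG, hG,
        smul_eq_mul, ← Complex.exp_add, Weyl.directSumForm_diagEmb hn]
      congr 1
      -- The summed mean sees only `∑ fᵢ`, which averaging over the diagonal preserves.
      have e1 : (∑ i : Fin n, m ∘ₗ LinearMap.proj i) (Weyl.diagEmb H n (Weyl.normSum H n f))
          = (∑ i : Fin n, m ∘ₗ LinearMap.proj i) f := by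
        simp only [LinearMap.sum_apply, LinearMap.comp_apply, LinearMap.proj_apply,
          Weyl.diagEmb_apply, Weyl.normSum_apply, map_smul, map_sum, Finset.sum_const, Finset.card_univ, Fintype.card_fin,
          smul_eq_mul, nsmul_eq_mul]
        rw [← Finset.mul_sum, ← Finset.mul_sum, ← mul_assoc, ← mul_assoc,
          Weyl.sqrt_inv_mul_sqrt_inv, inv_mul_cancel₀ hn', one_mul]
      have e2 : α (Weyl.normSum H n f) (Weyl.normSum H n f)
          = (n : ℝ)⁻¹ * α (∑ i, f i) (∑ i, f i) := by
        rw [Weyl.normSum_apply, map_smul, map_smul, LinearMap.smul_apply, smul_smul,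
          Weyl.sqrt_inv_mul_sqrt_inv, smul_eq_mul]
      rw [e1, e2, Weyl.directSumForm_apply]
      push_cast
      ring
    have hTc := Weyl.isCoarseGraining_of_map_one T hT1
    have hSc := Weyl.isCoarseGraining_of_map_one S hS1
    exact ⟨⟨hTc, S.toLinearMap, hSc, hST⟩, S, hSc, hS, hST⟩
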